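/- A topological space $G$ is \emph{rectifiable} if there are a homeomorphism $\varphi$ of $G\times G$ onto itself and a point $e\in G$ such that $\pi_1\circ\varphi=\pi_1$ (where $\pi_1$ is the projection to the first coordinate) and $\varphi(x,x)=(x,e)$ for every $x\in G$. A \emph{GO-space} (suborderable space) is a topological space that is homeomorphic to a subspace of a linearly ordered set with its order topology. Theorem. Let $G$ be a rectifiable space which is a GO-space. Then $G$ is metrizable if at least one of the following holds: (1) $G$ is locally separable, i.e. every point of $G$ has a separable neighborhood; (2) every one-point subset of $G$ is a $G_\delta$-set; (3) $G$ is a quasi-$k$-space, i.e. $G$ has a cover $\mathscr{C}$ by countably compact subsets such that a set $A\subset G$ is open in $G$ whenever $A\cap C$ is open in $C$ for every $C\in\mathscr{C}$; (4) $G$ has countable tightness, i.e. whenever $x\in\overline{A}$ with $A\subset G$, there is a countable $B\subset A$ with $x\in\overline{B}$; (5) $G$ is a $\Sigma$-space, or, more generally, every point of $G$ has a neighborhood that is a $\Sigma$-space; here a space $X$ is a $\Sigma$-space if there are a $\sigma$-locally finite closed cover $\mathscr{F}$ of $X$ and a cover $\mathscr{C}$ of $X$ by countably compact closed subsets such that,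 whenever $C\in\mathscr{C}$, $U$ is open in $X$ and $C\subset U$, there is $F\in\mathscr{F}$ with $C\subset F\subset U$; (6) some countably compact subset of $G$ is infinite; (7) some connected subset of $G$ contains at least two points. -/

import Mathlib

open Set Topology

universe u

/-- A space `G` is rectifiable: there are a homeomorphism `φ` of `G × G` onto itself and a point
`e` with `π₁ ∘ φ = π₁` and `φ (x, x) = (x, e)` for every `x`. -/
def IsRectifiable (G : Type u) [TopologicalSpace G] : Prop :=
  ∃ (φ : (G × G) ≃ₜ (G × G)) (e : G),
    (∀ z : G × G, (φ z).1 = z.1) ∧ ∀ x : G, φ (x, x) = (x, e)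

/-- An ordered space `(X, τ, ≤)` is a GO-space: it is a subspace of a linearly ordered topological
space `Y`, the order of `X` being induced by that of `Y`. -/
def IsGOSpace (X : Type u) [TopologicalSpace X] [LinearOrder X] : Prop :=
  ∃ (Y : Type u) (_ : LinearOrder Y) (_ : TopologicalSpace Y) (_ : OrderTopology Y) (f : X ↪o Y),
    IsEmbedding f

/-- A topological space is suborderable (a GO-space, when no order is singled out): some linear
order on it makes it a GO-space. -/
def IsSuborderable (X : Type u) [TopologicalSpace X] : Prop :=
  ∃ _ : LinearOrder X, IsGOSpace X

/-- Every point has a separable neighbourhood. -/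
def IsLocallySeparable (X : Type u) [TopologicalSpace X] : Prop :=
  ∀ x : X, ∃ N ∈ 𝓝 x, TopologicalSpace.SeparableSpace N

/-- A quasi-`k`-space: it has a cover by countably compact subsets which determines its topology,
i.e. a set is open as soon as its trace on each member of the cover is relatively open. -/
def IsQuasiKSpace (X : Type u) [TopologicalSpace X] : Prop :=
  ∃ 𝒞 : Set (Set X), ⋃₀ 𝒞 = univ ∧ (∀ C ∈ 𝒞, IsCountablyCompact C) ∧ IsCoherentWith 𝒞

/-- Countable tightness, `t(X) ≤ ω`. -/
def HasCountableTightness (X : Type u) [TopologicalSpace X] : Prop :=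
  ∀ (A : Set X), ∀ x ∈ closure A, ∃ B ⊆ A, B.Countable ∧ x ∈ closure B

/-- A `Σ`-space: there are a `σ`-locally finite closed cover `⋃ n, 𝓕 n` and a cover `𝒞` by
countably compact closed sets such that whenever `C ∈ 𝒞` lies in an open set `U`, some member `F`
of the first cover satisfies `C ⊆ F ⊆ U`. -/
def IsCapitalSigmaSpace (X : Type u) [TopologicalSpace X] : Prop :=
  ∃ (𝓕 : ℕ → Set (Set X)) (𝒞 : Set (Set X)),
    (∀ n, LocallyFinite (fun F : 𝓕 n => (F : Set X))) ∧
    (∀ n, ∀ F ∈ 𝓕 n, IsClosed F) ∧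
    ⋃₀ (⋃ n, 𝓕 n) = univ ∧
    (∀ C ∈ 𝒞, IsClosed C ∧ IsCountablyCompact C) ∧
    ⋃₀ 𝒞 = univ ∧
    ∀ C ∈ 𝒞, ∀ U : Set X, IsOpen U → C ⊆ U → ∃ F ∈ ⋃ n, 𝓕 n, C ⊆ F ∧ F ⊆ U

/-- Every point has a neighbourhood which is a `Σ`-space. -/
def IsLocallyCapitalSigmaSpace (X : Type u) [TopologicalSpace X] : Prop :=
  ∀ x : X, ∃ N ∈ 𝓝 x, IsCapitalSigmaSpace N

/-!
The proof is a dichotomy. Write a rectification as a pair of continuous operations `p`, `q` with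
`p x (q x y) = y`, `q x (p x y) = y` and `q x x = e`.

*Countable character at `e`.* Then `G` is metrizable, without any use of the order. A countable base
at `e` gives symmetric open relations `D n` on `G` such that every neighbourhood of a point `x`
contains `D n` of some neighbourhood of `x`, for `n` depending on `x`. There is no uniformity in `x`,
so a uniform structure cannot be read off directly, but Rudin's proof of Stone's theorem needs only
this much and shows that `G` is paracompact (`paracompactSpace_of_symm_nhds`). Functions with
supports subordinate to the covers `{D n x}` then embed `G` into a metrizable space
(`metrizableSpace_of_symm_nhds`, `metrizableSpace_of_rectification`).

*Uncountable character at `e`.* If a point of a GO-space is not a `P`-point, then a sequence converges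
to it monotonically from one side, and the intervals between the terms and the point form a countable
local `π`-base (`IsGOSpace.exists_countable_piBase`). In a rectifiable space, a countable local
`π`-base anywhere can be translated into a countable base at `e`
(`nhds_isCountablyGenerated_of_rectification`). Hence here every point is a `P`-point, which is
expressed by `CountableInterFilter (𝓝 x)`. In such a space countable sets are closed, countably
compact sets are finite, zero sets are clopen, and `Σ`-spaces are discrete. Each of the alternative
conditions thus produces an isolated point or a direct contradiction; and an isolated point makes `e`
isolated, contrary to the uncountable character.
-/

open Filter

/-! ### Metrization by symmetric neighbourhood assignments -/

/-- A version of Stone's theorem. Each `D n` is a symmetric open neighbourhood assignment,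
decreasing in `n`, and `D n` maps a neighbourhood of `x` into a prescribed one for large `n`
*depending on `x`*. M. E. Rudin's proof of paracompactness of metric spaces goes through: the `D n x`
replace the balls `B(x, 2⁻ⁿ)`, and a bound on a chain of four `D n`-steps replaces each use of the
triangle inequality. -/
theorem paracompactSpace_of_symm_nhds {X : Type*} [TopologicalSpace X] (D : ℕ → X → Set X)
    (hopen : ∀ n x, IsOpen (D n x)) (hself : ∀ n x, x ∈ D n x)
    (hsymm : ∀ n x y, y ∈ D n x → x ∈ D n y) (hanti : ∀ m n x, m ≤ n → D n x ⊆ D m x)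
    (hD : ∀ x, ∀ W ∈ 𝓝 x, ∃ V ∈ 𝓝 x, ∃ n, ∀ y ∈ V, D n y ⊆ W) :
    ParacompactSpace X := by
  refine ⟨fun ι s ho hcov => ?_⟩
  simp only [iUnion_eq_univ_iff] at hcov
  obtain ⟨_, wf⟩ := exists_wellFoundedLT ι
  let ind (x : X) : ι := wellFounded_lt.min { i : ι | x ∈ s i } (hcov x)
  have mem_ind (x) : x ∈ s (ind x) := wellFounded_lt.min_mem _ (hcov x)
  have notMem_of_lt_ind {x i} (hlt : i < ind x) (hxi : x ∈ s i) : False :=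
    wellFounded_lt.not_lt_min {i | x ∈ s i} hxi hlt
  -- The refinement `E n i` is the union of the sets `D n x` over the `x` whose first index is `i`,
  -- such that all `D n`-chains of length four from `x` stay in `s i`, and which are in no earlier
  -- `E m j`.
  set E : ℕ → ι → Set X :=
    Nat.strongRec fun n E' i ↦
      {y | ∃ x, ind x = i ∧ (∀ a ∈ D n x, ∀ b ∈ D n a, ∀ c ∈ D n b, D n c ⊆ s i) ∧
        (∀ (m : ℕ) (H : m < n), ∀ j : ι, x ∉ E' m H j) ∧ y ∈ D n x} with hE
  have memE {n i y} : y ∈ E n i ↔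
      ∃ x, ind x = i ∧ (∀ a ∈ D n x, ∀ b ∈ D n a, ∀ c ∈ D n b, D n c ⊆ s i) ∧
        (∀ m < n, ∀ j, x ∉ E m j) ∧ y ∈ D n x := by
    simp only [hE]
    rw [Nat.strongRec_eq]
    rfl
  -- Applying `hD` four times in a row bounds chains of length four issuing from `x`.
  have Ecov (x) : ∃ n i, x ∈ E n i := by
    obtain ⟨V₁, hV₁, n₁, h₁⟩ := hD x _ ((ho _).mem_nhds (mem_ind x))
    obtain ⟨V₂, hV₂, n₂, h₂⟩ := hD x V₁ hV₁
    obtain ⟨V₃, hV₃, n₃, h₃⟩ := hD x V₂ hV₂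
    obtain ⟨V₄, hV₄, n₄, h₄⟩ := hD x V₃ hV₃
    let n := max (max n₁ n₂) (max n₃ n₄)
    by_contra! h
    refine h n (ind x) (memE.2 ⟨x, rfl, fun a ha b hb c hc => ?_, fun _ _ _ => h _ _, hself _ _⟩)
    have ha' := h₄ x (mem_of_mem_nhds hV₄) (hanti n₄ n _ (by simp [n]) ha)
    have hb' := h₃ a ha' (hanti n₃ n _ (by simp [n]) hb)
    have hc' := h₂ b hb' (hanti n₂ n _ (by simp [n]) hc)
    exact (hanti n₁ n _ (by simp [n])).trans (h₁ c hc')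
  have Eopen (n i) : IsOpen (E n i) := by
    rw [isOpen_iff_mem_nhds]
    intro y hy
    obtain ⟨x, h1, h2, h3, h4⟩ := memE.1 hy
    filter_upwards [(hopen n x).mem_nhds h4] with z hz
    exact memE.2 ⟨x, h1, h2, h3, hz⟩
  have EsubS (n i) : E n i ⊆ s i := by
    intro y hy
    obtain ⟨x, -, h2, -, h4⟩ := memE.1 hy
    exact h2 x (hself _ _) x (hself _ _) x (hself _ _) h4
  refine ⟨ℕ × ι, fun ni => E ni.1 ni.2, fun _ => Eopen _ _, ?_, ?_, fun ni => ⟨ni.2, EsubS _ _⟩⟩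
  · exact iUnion_eq_univ_iff.2 fun x ↦ let ⟨n, i, h⟩ := Ecov x; ⟨⟨n, i⟩, h⟩
  · intro x
    obtain ⟨n, i, hn⟩ := Ecov x
    obtain ⟨V, hV, k, hk⟩ := hD x _ ((Eopen n i).mem_nhds hn)
    let N := max (n + 1) k
    refine ⟨V ∩ D N x, inter_mem hV ((hopen _ _).mem_nhds (hself _ _)), ?_⟩
    -- The centres of the sets forming `E m j` avoid `E n i` once `n < m`, while `hk` would put the
    -- centre into `E n i`.
    have Hgt (m) (hm : N ≤ m) (j : ι) : ¬ (E m j ∩ (V ∩ D N x)).Nonempty := by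
      rintro ⟨y, hy, hyV, -⟩
      obtain ⟨z, -, -, h3, h4⟩ := memE.1 hy
      exact h3 n ((le_max_left _ _).trans hm) i
        (hk y hyV (hanti k m _ ((le_max_right _ _).trans hm) (hsymm _ _ _ h4)))
    -- Two members `E m j₁` and `E m j₂` meeting `D N x` would give the chain `y', y, x, z, z'` of
    -- `D m`-steps from a centre with index `j₁` to one with index `j₂`.
    have Hle (m) (hm : m < N) : {j | (E m j ∩ (V ∩ D N x)).Nonempty}.Subsingleton := by
      rintro j₁ ⟨y, hyE, -, hyx⟩ j₂ ⟨z, hzE, -, hzx⟩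
      by_contra h' : j₁ ≠ j₂
      wlog h : j₁ < j₂ generalizing j₁ j₂ y z
      · exact this z hzE hzx y hyE hyx h'.symm (h'.lt_or_gt.resolve_left h)
      obtain ⟨y', rfl, hsub, -, hy⟩ := memE.1 hyE
      obtain ⟨z', rfl, -, -, hz⟩ := memE.1 hzE
      exact notMem_of_lt_ind h (hsub y hy x (hsymm _ _ _ (hanti m N _ hm.le hyx)) z
        (hanti m N _ hm.le hzx) (hsymm _ _ _ hz))
    have : (⋃ (m < N) (j ∈ {j | (E m j ∩ (V ∩ D N x)).Nonempty}), {(m, j)}).Finite :=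
      (finite_lt_nat _).biUnion' fun m hm =>
        (Hle m hm).finite.biUnion' fun _ _ => finite_singleton _
    refine this.subset fun I hI => ?_
    simp only [mem_iUnion]
    exact ⟨I.1, not_le.1 fun hle => Hgt I.1 hle I.2 hI, I.2, hI, rfl⟩

/-- Near a given point only finitely many of the functions are nonzero, so continuity of each of them
gives continuity uniform in the index. -/
theorem continuous_uniformFun_of_locallyFinite_support {ι X : Type*} [TopologicalSpace X]
    (f : ι → C(X, ℝ)) (hf : LocallyFinite fun i => Function.support (f i)) :
    Continuous fun x => UniformFun.ofFun fun i => f i x := by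
  rw [continuous_iff_continuousAt]
  intro x
  rw [ContinuousAt, UniformFun.tendsto_iff_tendstoUniformly, Metric.tendstoUniformly_iff]
  intro ε hε
  obtain ⟨t, ht, hfin⟩ := hf x
  have h1 : ∀ᶠ y in 𝓝 x, ∀ i ∈ {i | (Function.support (f i) ∩ t).Nonempty},
      dist (f i x) (f i y) < ε := by
    refine (eventually_all_finite hfin).2 fun i _ => ?_
    have := (f i).continuous.continuousAt (x := x)
    filter_upwards [this (Metric.ball_mem_nhds _ hε)] with y hy
    rw [dist_comm]; exact hy
  filter_upwards [h1, ht] with y hy hyt i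
  by_cases hi : (Function.support (f i) ∩ t).Nonempty
  · exact hy i hi
  · have hz : ∀ z ∈ t, f i z = 0 := fun z hz => by
      by_contra h; exact hi ⟨z, h, hz⟩
    simpa [UniformFun.toFun, UniformFun.ofFun, hz x (mem_of_mem_nhds ht), hz y hyt] using hε

/-- A metrization theorem of Moore–Arhangel'skii type for symmetric open neighbourhood assignments.
By paracompactness there is, for each `n`, a locally finite family of continuous functions `f n i`
supported in `D n i` which at every point has a member equal to `1`; these families together embed
the space into a countable product of spaces of functions with the metric of uniform convergence. -/
theorem metrizableSpace_of_symm_nhds {X : Type*} [TopologicalSpace X] [T2Space X]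
    (D : ℕ → X → Set X)
    (hopen : ∀ n x, IsOpen (D n x)) (hself : ∀ n x, x ∈ D n x)
    (hsymm : ∀ n x y, y ∈ D n x → x ∈ D n y) (hanti : ∀ m n x, m ≤ n → D n x ⊆ D m x)
    (hD : ∀ x, ∀ W ∈ 𝓝 x, ∃ V ∈ 𝓝 x, ∃ n, ∀ y ∈ V, D n y ⊆ W) :
    TopologicalSpace.MetrizableSpace X := by
  have := paracompactSpace_of_symm_nhds D hopen hself hsymm hanti hD
  have hex (n : ℕ) : ∃ f : BumpCovering X X univ, f.IsSubordinate (D n) :=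
    BumpCovering.exists_isSubordinate isClosed_univ _ (hopen n)
      fun x _ => mem_iUnion.2 ⟨x, hself n x⟩
  choose f hf using hex
  let F : X → ℕ → (UniformFun X ℝ) := fun x n => UniformFun.ofFun fun i => f n i x
  have hF : IsInducing F := by
    refine isInducing_iff_nhds.2 fun x => le_antisymm ?_ fun W hW => ?_
    · refine (Continuous.tendsto ?_ x).le_comap
      exact continuous_pi fun n =>
        continuous_uniformFun_of_locallyFinite_support (f n) (f n).locallyFinite
    · obtain ⟨V₁, hV₁, n₁, h₁⟩ := hD x W hW
      obtain ⟨V₂, hV₂, n₂, h₂⟩ := hD x V₁ hV₁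
      let n := max n₁ n₂
      -- Wherever `f n i` is positive, the point lies in `D n i`, hence two `D n`-steps away from `x`.
      obtain ⟨i, hi⟩ := (f n).eventuallyEq_one' x (mem_univ x)
      have hev : Continuous fun g : ℕ → (UniformFun X ℝ) => UniformFun.toFun (g n) i :=
        (UniformFun.uniformContinuous_eval ℝ i).continuous.comp (continuous_apply n)
      have hpos : {g : ℕ → (UniformFun X ℝ) | 0 < UniformFun.toFun (g n) i} ∈ 𝓝 (F x) := by
        refine (isOpen_lt continuous_const hev).mem_nhds ?_
        have : f n i x = 1 := hi.self_of_nhds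
        change 0 < f n i x
        rw [this]; exact one_pos
      refine ⟨_, hpos, fun y hy => ?_⟩
      have hy' : 0 < f n i y := hy
      have hyD : y ∈ D n i := hf n i (subset_tsupport _ hy'.ne')
      have hxD : x ∈ D n i := hf n i (subset_tsupport _ (by
        have : f n i x = 1 := hi.self_of_nhds
        change f n i x ≠ 0
        rw [this]; exact one_ne_zero))
      exact h₁ i (h₂ x (mem_of_mem_nhds hV₂) (hanti n₂ n _ (le_max_right _ _) (hsymm _ _ _ hxD)))
        (hanti n₁ n _ (le_max_left _ _) hyD)
  have := hF.pseudoMetrizableSpace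
  infer_instance

/-! ### Rectifiable spaces -/

/-- A rectification `φ` amounts to two continuous operations `p` and `q`, where `φ (x, y) = (x, q x y)`
and `φ⁻¹ (x, y) = (x, p x y)`. In a topological group `p x y = x * y` and `q x y = x⁻¹ * y` qualify. -/
theorem IsRectifiable.exists_operations {G : Type u} [TopologicalSpace G] (h : IsRectifiable G) :
    ∃ (e : G) (p q : G → G → G), Continuous (fun z : G × G => p z.1 z.2) ∧
      Continuous (fun z : G × G => q z.1 z.2) ∧ (∀ x, q x x = e) ∧
      (∀ x y, p x (q x y) = y) ∧ ∀ x y, q x (p x y) = y := by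
  obtain ⟨φ, e, hφ, he⟩ := h
  have hφ' (z : G × G) : (φ.symm z).1 = z.1 := by
    rw [← hφ (φ.symm z), φ.apply_symm_apply]
  refine ⟨e, fun x y => (φ.symm (x, y)).2, fun x y => (φ (x, y)).2,
    continuous_snd.comp φ.symm.continuous, continuous_snd.comp φ.continuous,
    fun x => by simp [he], fun x y => ?_, fun x y => ?_⟩
  · have : (x, (φ (x, y)).2) = φ (x, y) := Prod.ext (hφ (x, y)).symm rfl
    simp [this]
  · have : (x, (φ.symm (x, y)).2) = φ.symm (x, y) := Prod.ext (hφ' (x, y)).symm rfl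
    simp [this]

section Operations

variable {G : Type*} [TopologicalSpace G] {e : G} {p q : G → G → G}

/-- A Hausdorff rectifiable space with countable character at `e` is metrizable. For a countable base
`B n` at `e`, the relations `q x y, q y x ∈ interior (B n)` are symmetric and open; continuity of `p`
at `(x, e)`, together with `p y (q y z) = z`, shows that they satisfy the hypothesis of the
metrization theorem. -/
theorem metrizableSpace_of_rectification [T2Space G]
    (hp : Continuous (fun z : G × G => p z.1 z.2)) (hq : Continuous (fun z : G × G => q z.1 z.2))
    (hqe : ∀ x, q x x = e) (hpq : ∀ x y, p x (q x y) = y) (hc : (𝓝 e).IsCountablyGenerated) :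
    TopologicalSpace.MetrizableSpace G := by
  have hpe (x : G) : p x e = x := by rw [← hqe x, hpq]
  obtain ⟨B, hB⟩ := (𝓝 e).exists_antitone_basis
  refine metrizableSpace_of_symm_nhds
    (fun n x => {y | q x y ∈ interior (B n) ∧ q y x ∈ interior (B n)})
    (fun n x => ?_) (fun n x => ?_) (fun n x y h => ⟨h.2, h.1⟩) (fun m n x hmn y hy => ?_)
    fun x W hW => ?_
  · exact (isOpen_interior.preimage (hq.comp (Continuous.prodMk_right x))).inter
      (isOpen_interior.preimage (hq.comp (Continuous.prodMk_left x)))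
  · have : e ∈ interior (B n) := mem_interior_iff_mem_nhds.2 (hB.mem n)
    simpa [hqe] using this
  · have := interior_mono (hB.antitone hmn)
    exact ⟨this hy.1, this hy.2⟩
  · have hW' : (fun z : G × G => p z.1 z.2) ⁻¹' W ∈ 𝓝 (x, e) :=
      hp.continuousAt (by simpa [hpe] using hW)
    obtain ⟨V, hV, U, hU, hVU⟩ := mem_nhds_prod_iff.1 hW'
    obtain ⟨n, -, hn⟩ := hB.1.mem_iff.1 hU
    refine ⟨V, hV, n, fun y hy z hz => ?_⟩
    have : p y (q y z) ∈ W := hVU (mk_mem_prod hy (hn (interior_subset hz.1)))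
    rwa [hpq] at this

/-- In a rectifiable space a countable local `π`-base at some point `x` yields a countable base at `e`:
if `a n ∈ O n`, the translates `q (a n) '' (O n) = (p (a n))⁻¹' (O n)` are neighbourhoods of `e`, and
they shrink to `e` since `q` is continuous at `(x, x)`. -/
theorem nhds_isCountablyGenerated_of_rectification
    (hp : Continuous (fun z : G × G => p z.1 z.2)) (hq : Continuous (fun z : G × G => q z.1 z.2))
    (hqe : ∀ x, q x x = e) (hpq : ∀ x y, p x (q x y) = y) (hqp : ∀ x y, q x (p x y) = y)
    {x : G} {O : ℕ → Set G} (hO : ∀ n, IsOpen (O n)) (hne : ∀ n, (O n).Nonempty)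
    (hx : ∀ W ∈ 𝓝 x, ∃ n, O n ⊆ W) : (𝓝 e).IsCountablyGenerated := by
  have hpe (x : G) : p x e = x := by rw [← hqe x, hpq]
  choose a ha using hne
  have hb : (𝓝 e).HasBasis (fun _ : ℕ => True) fun n => p (a n) ⁻¹' O n := by
    refine ⟨fun W => ⟨fun hW => ?_, fun ⟨n, _, hn⟩ => mem_of_superset ?_ hn⟩⟩
    · have hW' : (fun z : G × G => q z.1 z.2) ⁻¹' W ∈ 𝓝 (x, x) :=
        hq.continuousAt (by simpa [hqe] using hW)
      rw [nhds_prod_eq] at hW'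
      obtain ⟨V, hV, hVW⟩ := mem_prod_same_iff.1 hW'
      obtain ⟨n, hn⟩ := hx V hV
      refine ⟨n, trivial, fun z hz => ?_⟩
      have : q (a n) (p (a n) z) ∈ W := hVW (mk_mem_prod (hn (ha n)) (hn hz))
      rwa [hqp] at this
    · exact ((hO n).preimage (hp.comp (Continuous.prodMk_right (a n)))).mem_nhds
        (by simpa [hpe] using ha n)
  exact hb.isCountablyGenerated

/-- By homogeneity, if some point is isolated, then so is `e`. -/
theorem nhds_eq_pure_of_isOpen_singleton_of_rectification
    (hp : Continuous (fun z : G × G => p z.1 z.2))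
    (hqe : ∀ x, q x x = e) (hpq : ∀ x y, p x (q x y) = y) (hqp : ∀ x y, q x (p x y) = y)
    {x : G} (hx : IsOpen {x}) : 𝓝 e = pure e := by
  have hpe (x : G) : p x e = x := by rw [← hqe x, hpq]
  have : p x ⁻¹' {x} = {e} := by
    ext z
    refine ⟨fun hz => ?_, fun hz => by rw [mem_singleton_iff.1 hz]; exact hpe x⟩
    have hz' : p x z = x := hz
    rw [mem_singleton_iff, ← hqp x z, hz', hqe]
  exact (isOpen_singleton_iff_nhds_eq_pure e).1
    (this ▸ hx.preimage (hp.comp (Continuous.prodMk_right x)))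

end Operations

/-! ### Points of GO-spaces -/

theorem IsGOSpace.dual {X : Type u} [TopologicalSpace X] [LinearOrder X] (h : IsGOSpace X) :
    IsGOSpace Xᵒᵈ := by
  obtain ⟨Y, _, _, _, f, hf⟩ := h
  exact ⟨Yᵒᵈ, inferInstance, inferInstance, inferInstance, f.dual, hf⟩

theorem IsGOSpace.orderClosedTopology {X : Type u} [TopologicalSpace X] [LinearOrder X]
    (h : IsGOSpace X) : OrderClosedTopology X := by
  obtain ⟨Y, _, _, _, f, hf⟩ := h
  refine ⟨?_⟩
  have : {z : X × X | z.1 ≤ z.2} = {z : X × X | f z.1 ≤ f z.2} := by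
    ext z; simp
  rw [this]
  exact isClosed_le (hf.continuous.comp continuous_fst) (hf.continuous.comp continuous_snd)

theorem IsGOSpace.t5Space {X : Type u} [TopologicalSpace X] [LinearOrder X]
    (h : IsGOSpace X) : T5Space X := by
  obtain ⟨Y, _, _, _, f, hf⟩ := h
  exact hf.t5Space

theorem IsGOSpace.exists_Ico_subset {X : Type u} [TopologicalSpace X] [LinearOrder X]
    (h : IsGOSpace X) {x : X} (hx : x ∈ closure (Iio x)) {W : Set X} (hW : W ∈ 𝓝 x) :
    ∃ a < x, Ico a x ⊆ W := by
  obtain ⟨Y, _, _, _, f, hf⟩ := h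
  rw [hf.nhds_eq_comap] at hW
  obtain ⟨T, hT, hTW⟩ := hW
  obtain ⟨b, hb⟩ : (Iio x).Nonempty := closure_nonempty_iff.1 ⟨x, hx⟩
  obtain ⟨l, hl, hlT⟩ := exists_Ioc_subset_of_mem_nhds hT ⟨f b, f.lt_iff_lt.2 hb⟩
  obtain ⟨a, hla, hax⟩ := mem_closure_iff_nhds.1 hx _
    (hf.continuous.continuousAt (Ioi_mem_nhds hl))
  exact ⟨a, hax, fun c hc => hTW (hlT ⟨hla.trans_le (f.le_iff_le.2 hc.1), f.le_iff_le.2 hc.2.le⟩)⟩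

/-- If countably many neighbourhoods `V n` of `x` intersect in a set which is not a left neighbourhood
of `x`, then points `a n < x` with `[a n, x) ⊆ V n` are cofinal below `x`, so the intervals `(a n, x)`
form a local `π`-base at `x`. -/
theorem IsGOSpace.exists_countable_piBase_left {X : Type u} [TopologicalSpace X] [LinearOrder X]
    (h : IsGOSpace X) {x : X} {V : ℕ → Set X} (hV : ∀ n, V n ∈ 𝓝 x) (hnot : ⋂ n, V n ∉ 𝓝[≤] x) :
    ∃ O : ℕ → Set X, (∀ n, IsOpen (O n)) ∧ (∀ n, (O n).Nonempty) ∧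
      ∀ W ∈ 𝓝 x, ∃ n, O n ⊆ W := by
  have := h.orderClosedTopology
  have hxV : x ∈ ⋂ n, V n := mem_iInter.2 fun n => mem_of_mem_nhds (hV n)
  have hx : x ∈ closure (Iio x) := by
    by_contra hx
    refine hnot ?_
    rw [mem_closure_iff_nhdsWithin_neBot, not_neBot] at hx
    rw [← Iio_insert, nhdsWithin_insert, hx, sup_bot_eq]
    exact hxV
  choose a hax haV using fun n => h.exists_Ico_subset hx (hV n)
  refine ⟨fun n => Ioo (a n) x, fun n => isOpen_Ioo, fun n => ?_, fun W hW => ?_⟩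
  · exact mem_closure_iff_nhds.1 hx _ (Ioi_mem_nhds (hax n))
  · obtain ⟨b, hbx, hbW⟩ := h.exists_Ico_subset hx hW
    obtain ⟨n, hn⟩ : ∃ n, b ≤ a n := by
      by_contra! hlt
      refine hnot (mem_nhdsWithin_iff_exists_mem_nhds_inter.2 ⟨Ioi b, Ioi_mem_nhds hbx, ?_⟩)
      rintro c ⟨hbc, hcx⟩
      rcases eq_or_lt_of_le (show c ≤ x from hcx) with rfl | hcx
      · exact hxV
      · exact mem_iInter.2 fun n => haV n ⟨((hlt n).trans hbc).le, hcx⟩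
    exact ⟨n, fun c hc => hbW ⟨hn.trans hc.1.le, hc.2⟩⟩

/-- In a GO-space, a point which is not a `P`-point (that is, its neighbourhoods are not closed under
countable intersections) has a countable local `π`-base of nonempty open sets. -/
theorem IsGOSpace.exists_countable_piBase {X : Type u} [TopologicalSpace X] [LinearOrder X]
    (h : IsGOSpace X) {x : X} (hx : ¬ CountableInterFilter (𝓝 x)) :
    ∃ O : ℕ → Set X, (∀ n, IsOpen (O n)) ∧ (∀ n, (O n).Nonempty) ∧
      ∀ W ∈ 𝓝 x, ∃ n, O n ⊆ W := by
  obtain ⟨V, hV, hnot⟩ : ∃ V : ℕ → Set X, (∀ n, V n ∈ 𝓝 x) ∧ ⋂ n, V n ∉ 𝓝 x := by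
    by_contra! hall
    refine hx ⟨fun S hS hSx => ?_⟩
    rcases S.eq_empty_or_nonempty with rfl | hne
    · simp
    obtain ⟨V, rfl⟩ := hS.exists_eq_range hne
    rw [sInter_range]
    exact hall V fun n => hSx _ (mem_range_self n)
  rw [← nhdsLE_sup_nhdsGE, mem_sup, not_and_or] at hnot
  rcases hnot with hnot | hnot
  · exact h.exists_countable_piBase_left hV hnot
  · exact h.dual.exists_countable_piBase_left (x := OrderDual.toDual x) (V := V) hV hnot

/-! ### Spaces all of whose points are `P`-points -/

section CountableInter

variable {X : Type u} [TopologicalSpace X]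

theorem Set.Countable.isClosed_of_countableInterFilter [T1Space X]
    (hP : ∀ x : X, CountableInterFilter (𝓝 x)) {A : Set X} (hA : A.Countable) : IsClosed A := by
  rw [← isOpen_compl_iff, isOpen_iff_mem_nhds]
  intro x hx
  have := hP x
  have : ⋂ a ∈ A, {a}ᶜ ∈ 𝓝 x := (countable_bInter_mem hA).2 fun a ha =>
    isOpen_compl_singleton.mem_nhds fun h => hx (by rwa [mem_singleton_iff.1 h])
  refine mem_of_superset this fun y hy hyA => ?_
  exact mem_iInter₂.1 hy y hyA rfl

theorem isOpen_singleton_of_countable_mem_nhds [T1Space X]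
    (hP : ∀ x : X, CountableInterFilter (𝓝 x)) {x : X} {N : Set X} (hN : N ∈ 𝓝 x)
    (hc : N.Countable) : IsOpen {x} := by
  rw [isOpen_singleton_iff_nhds_eq_pure]
  refine le_antisymm (le_pure_iff.2 ?_) (pure_le_nhds x)
  have hcl : IsClosed (N \ {x}) := (hc.mono sdiff_subset).isClosed_of_countableInterFilter hP
  filter_upwards [hN, hcl.isOpen_compl.mem_nhds (by simp)] with y hyN hy
  by_contra hne
  exact hy ⟨hyN, hne⟩

theorem IsCountablyCompact.finite_of_countableInterFilter [T1Space X]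
    (hP : ∀ x : X, CountableInterFilter (𝓝 x)) {K : Set X} (hK : IsCountablyCompact K) :
    K.Finite := by
  by_contra hinf
  obtain ⟨A, hAK, hA⟩ : ∃ A ⊆ K, A.Countable ∧ A.Infinite := by
    have := Set.Infinite.natEmbedding K hinf
    refine ⟨range fun n => (this n : X), by rintro _ ⟨n, rfl⟩; exact (this n).2,
      countable_range _, infinite_range_of_injective
        (Subtype.val_injective.comp this.injective)⟩
  obtain ⟨a, -, ha⟩ := hK.exists_accPt_of_infinite hAK hA.2
  rw [accPt_principal_iff_clusterPt] at ha
  have hcl : IsClosed (A \ {a}) := (hA.1.mono sdiff_subset).isClosed_of_countableInterFilter hP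
  exact (isClosed_iff_clusterPt.1 hcl a ha).2 rfl

/-- A `T₁` `Σ`-space all of whose points are `P`-points is discrete. A neighbourhood `⋂ m, N m` of `x`
meets only countably many members of `⋃ n, 𝓕 n`. If a member `C` of `𝒞` meeting it were not in
`⋃ n, 𝓕 n`, a point could be picked in `F \ C` for each of these `F ⊇ C`; the points form a countable,
hence closed, set, whose complement contains `C` but no such `F`. So the neighbourhood is covered by
countably many members of `𝒞`, which are finite, and is therefore countable. -/
theorem isOpen_singleton_of_isCapitalSigmaSpace [T1Space X]
    (hP : ∀ x : X, CountableInterFilter (𝓝 x)) (hS : IsCapitalSigmaSpace X) (x : X) :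
    IsOpen {x} := by
  obtain ⟨𝓕, 𝒞, hlf, -, -, hC, hcov, hCF⟩ := hS
  have := hP x
  choose N hN hNfin using fun n => hlf n x
  have hlc : (⋃ n, {F | F ∈ 𝓕 n ∧ (F ∩ ⋂ m, N m).Nonempty}).Countable := by
    refine countable_iUnion fun n => ?_
    refine ((hNfin n).image Subtype.val).countable.mono ?_
    rintro F ⟨hF, hne⟩
    exact ⟨⟨F, hF⟩, hne.mono (inter_subset_inter_right _ (iInter_subset _ _)), rfl⟩
  have hmem : ∀ C ∈ 𝒞, (C ∩ ⋂ m, N m).Nonempty → C ∈ ⋃ n, 𝓕 n := by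
    intro C hCC hne
    by_contra hnot
    let 𝓢 := {F ∈ ⋃ n, {F | F ∈ 𝓕 n ∧ (F ∩ ⋂ m, N m).Nonempty} | C ⊆ F}
    have h𝓢 : 𝓢.Countable := hlc.mono (sep_subset _ _)
    have hpick : ∀ F ∈ 𝓢, (F \ C).Nonempty := by
      rintro F ⟨hF, hCF⟩
      rw [sdiff_nonempty]
      intro hFC
      obtain ⟨n, hn, -⟩ := mem_iUnion.1 hF
      exact hnot (hCF.antisymm hFC ▸ mem_iUnion.2 ⟨n, hn⟩)
    have : Nonempty X := ⟨x⟩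
    choose! y hy using hpick
    have hcl : IsClosed (y '' 𝓢) := (h𝓢.image y).isClosed_of_countableInterFilter hP
    obtain ⟨F, hF, hCF', hFU⟩ := hCF C hCC _ hcl.isOpen_compl (by
      rintro c hc ⟨F, hF, rfl⟩
      exact (hy F hF).2 hc)
    obtain ⟨n, hn⟩ := mem_iUnion.1 hF
    have hF𝓢 : F ∈ 𝓢 :=
      ⟨mem_iUnion.2 ⟨n, hn, hne.mono (inter_subset_inter_left _ hCF')⟩, hCF'⟩
    exact hFU (hy F hF𝓢).1 (mem_image_of_mem y hF𝓢)
  refine isOpen_singleton_of_countable_mem_nhds hP (countable_iInter_mem.2 hN) ?_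
  refine (Countable.biUnion (hlc.mono (sep_subset _ (fun C => C ∈ 𝒞))) (t := fun C _ => C)
    fun C hC' => ?_).mono ?_
  · exact ((hC C hC'.2).2.finite_of_countableInterFilter hP).countable
  · intro y hy
    obtain ⟨C, hCC, hyC⟩ := mem_sUnion.1 (hcov.symm ▸ mem_univ y)
    obtain ⟨n, hn⟩ := mem_iUnion.1 (hmem C hCC ⟨y, hyC, hy⟩)
    exact mem_biUnion (x := C) ⟨mem_iUnion.2 ⟨n, hn, ⟨y, hyC, hy⟩⟩, hCC⟩ hyC

/-- When all points of a normal space are `P`-points, zero sets of continuous functions are clopen, so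
Urysohn functions disconnect every set with two points. -/
theorem IsPreconnected.subsingleton_of_countableInterFilter [T4Space X]
    (hP : ∀ x : X, CountableInterFilter (𝓝 x)) {C : Set X} (hC : IsPreconnected C) :
    C.Subsingleton := by
  intro a ha b hb
  by_contra hne
  obtain ⟨f, hf0, hf1, -⟩ := exists_continuous_zero_one_of_isClosed
    (isClosed_singleton (x := a)) (isClosed_singleton (x := b)) (by simpa using hne)
  have hopen : IsOpen (f ⁻¹' {0}) := by
    rw [isOpen_iff_mem_nhds]
    intro x hx
    have := hP x
    have hball : ⋂ n : ℕ, f ⁻¹' Metric.ball 0 (1 / ((n : ℝ) + 1)) ∈ 𝓝 x :=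
      countable_iInter_mem.2 fun n => f.continuous.continuousAt (by
        rw [mem_preimage.1 hx]
        exact Metric.ball_mem_nhds _ Nat.one_div_pos_of_nat)
    refine mem_of_superset hball fun y hy => ?_
    by_contra hy0
    obtain ⟨n, hn⟩ := exists_nat_one_div_lt (abs_pos.2 hy0)
    have := mem_iInter.1 hy n
    simp only [mem_preimage, Metric.mem_ball, dist_zero_right, Real.norm_eq_abs] at this
    exact lt_asymm hn this
  have hclopen : IsClopen (f ⁻¹' {0}) := ⟨isClosed_singleton.preimage f.continuous, hopen⟩
  have := hC.subset_isClopen hclopen ⟨a, ha, hf0 rfl⟩ hb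
  rw [mem_preimage, hf1 rfl] at this
  simp at this

end CountableInter

/-! ### Metrizability of rectifiable GO-spaces -/

theorem theoremt10 (G : Type u) [TopologicalSpace G]
    (hrect : IsRectifiable G) (hGO : IsSuborderable G)
    (h : IsLocallySeparable G ∨
      (∀ x : G, IsGδ ({x} : Set G)) ∨
      IsQuasiKSpace G ∨
      HasCountableTightness G ∨
      (IsCapitalSigmaSpace G ∨ IsLocallyCapitalSigmaSpace G) ∨
      (∃ K : Set G, IsCountablyCompact K ∧ K.Infinite) ∨
      (∃ C : Set G, IsConnected C ∧ C.Nontrivial)) :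
    TopologicalSpace.MetrizableSpace G := by
  obtain ⟨_, hGO⟩ := hGO
  have := hGO.t5Space
  obtain ⟨e, p, q, hp, hq, hqe, hpq, hqp⟩ := hrect.exists_operations
  by_cases hc : (𝓝 e).IsCountablyGenerated
  · exact metrizableSpace_of_rectification hp hq hqe hpq hc
  exfalso
  have hP (x : G) : CountableInterFilter (𝓝 x) := by
    by_contra hx
    obtain ⟨O, hO, hne, hOx⟩ := hGO.exists_countable_piBase hx
    exact hc (nhds_isCountablyGenerated_of_rectification hp hq hqe hpq hqp hO hne hOx)
  have hiso (x : G) : ¬ IsOpen {x} := fun hx => hc <| by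
    rw [nhds_eq_pure_of_isOpen_singleton_of_rectification hp hqe hpq hqp hx]
    infer_instance
  have hPsub (N : Set G) (x : N) : CountableInterFilter (𝓝 x) := by
    have := hP x
    rw [nhds_subtype]
    infer_instance
  -- A neighbourhood of `e`, as a subspace, does not have `e` as an isolated point either.
  have hisosub {N : Set G} (hN : N ∈ 𝓝 e) : ¬ IsOpen {(⟨e, mem_of_mem_nhds hN⟩ : N)} := by
    intro hopen
    refine hiso e ?_
    rw [isOpen_singleton_iff_nhds_eq_pure, ← map_nhds_subtype_coe_eq_nhds (mem_of_mem_nhds hN) hN,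
      (isOpen_singleton_iff_nhds_eq_pure _).1 hopen, map_pure]
  rcases h with h | h | h | h | (h | h) | ⟨K, hK, hinf⟩ | ⟨C, hC, hnt⟩
  · obtain ⟨N, hN, hsep⟩ := h e
    obtain ⟨A, hA, hdense⟩ := TopologicalSpace.exists_countable_dense N
    have hAuniv : A = univ := by
      rw [← (hA.isClosed_of_countableInterFilter (hPsub N)).closure_eq, hdense.closure_eq]
    exact hisosub hN (isOpen_singleton_of_countable_mem_nhds (hPsub N) univ_mem (hAuniv ▸ hA))
  · obtain ⟨S, hSo, hS, hSe⟩ := h e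
    refine hiso e ?_
    rw [isOpen_singleton_iff_nhds_eq_pure]
    refine le_antisymm (le_pure_iff.2 ?_) (pure_le_nhds e)
    have := hP e
    rw [hSe]
    exact (countable_sInter_mem hS).2 fun s hs =>
      (hSo s hs).mem_nhds (mem_sInter.1 (hSe ▸ mem_singleton e) s hs)
  · obtain ⟨𝒞, -, hcc, hcoh⟩ := h
    refine hiso e (hcoh.isOpen_of_forall_induced _ fun C hC => ?_)
    have := (hcc C hC).finite_of_countableInterFilter hP
    have : Finite C := this
    exact isOpen_discrete _
  · refine hiso e ?_
    rw [← isClosed_compl_iff, ← closure_subset_iff_isClosed]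
    intro x hx
    obtain ⟨B, hB, hBc, hxB⟩ := h _ x hx
    rw [(hBc.isClosed_of_countableInterFilter hP).closure_eq] at hxB
    exact hB hxB
  · exact hiso e (isOpen_singleton_of_isCapitalSigmaSpace hP h e)
  · obtain ⟨N, hN, hS⟩ := h e
    exact hisosub hN (isOpen_singleton_of_isCapitalSigmaSpace (hPsub N) hS _)
  · exact hinf (hK.finite_of_countableInterFilter hP)
  · exact hnt.not_subsingleton (hC.isPreconnected.subsingleton_of_countableInterFilter hP)
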